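/- For integers $m,q\ge 1$ and a finite graph $G$, the $(m:q)$ Connector-Breaker game on $E(G)$ is played in rounds. In each round, Connector first claims at most $m$ edges of $G$ not claimed before by either player, chosen so that the graph formed by all her edges so far is connected (apart from vertices of $G$ that none of her edges covers); then Breaker claims at most $q$ edges of $G$ not claimed before by either player. Let $G_{n,p}$ denote the binomial random graph on $n$ labelled vertices, in which each of the $\binom n2$ possible edges is present independently with probability $p$. Theorem. Let $\varepsilon>0$ be a constant and let $p=p(n)\in[0,1]$ satisfy $p(n)\le n^{-2/3-\varepsilon}$ for all sufficiently large $n$. Then, with probability tending to $1$ as $n\to\infty$, the random graph $G\sim G_{n,p(n)}$ has the following property: in the $(2:2)$ Connector-Breaker game on $E(G)$, Breaker has a strategy such that, however Connector plays, there is a vertex of $G$ that remains isolated in Connector's graph (viewed as a graph on $V(G)$) throughout the game. -/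

import Mathlib

open Filter Topology

namespace ConnectorBreaker

variable {V : Type*}

/-- The edges that a player has claimed during the first `k` rounds, if `move i` is the set of
edges claimed in round `i` (rounds are numbered `0, 1, 2, …`). -/
def claimed (move : ℕ → Set (Sym2 V)) (k : ℕ) : Set (Sym2 V) :=
  {e | ∃ i < k, e ∈ move i}

/-- The graph on all of `V` formed by the edges in the moves of the first `k` rounds. -/
def graphAfter (move : ℕ → Set (Sym2 V)) (k : ℕ) : SimpleGraph V :=
  SimpleGraph.fromEdgeSet (claimed move k)

/-- A graph formed by claimed edges is connected if any two vertices covered by its edges are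
joined by a path in it; vertices not covered by any edge do not matter. -/
def EdgesConnected (H : SimpleGraph V) : Prop :=
  ∀ u ∈ H.support, ∀ v ∈ H.support, H.Reachable u v

/-- Connector, who moves first in each round, obeys the rules: in every round she claims at most
`m` edges of `G`, all of them free, so that her graph stays connected. -/
def ConnectorLegal (G : SimpleGraph V) (m : ℕ) (c b : ℕ → Set (Sym2 V)) : Prop :=
  ∀ k, c k ⊆ G.edgeSet \ (claimed c k ∪ claimed b k) ∧ (c k).encard ≤ m ∧
    EdgesConnected (graphAfter c (k + 1))

/-- Breaker, who moves second in each round, obeys the rules: in every round he claims at most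
`q` edges of `G`, all of them free. -/
def BreakerLegal (G : SimpleGraph V) (q : ℕ) (c b : ℕ → Set (Sym2 V)) : Prop :=
  ∀ k, b k ⊆ G.edgeSet \ (claimed c (k + 1) ∪ claimed b k) ∧ (b k).encard ≤ q

/-- A (deterministic) strategy of Breaker: his next move as a function of the chronological list
of all moves Connector has made so far. (His own previous moves are determined by these.) -/
abbrev BreakerStrategy (V : Type*) : Type _ := List (Set (Sym2 V)) → Set (Sym2 V)

/-- Breaker's moves when he follows `σ` against the sequence `c` of Connector's moves: in round
`k` he has seen Connector's moves `c 0, …, c k`. -/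
def BreakerStrategy.response (σ : BreakerStrategy V) (c : ℕ → Set (Sym2 V)) (k : ℕ) :
    Set (Sym2 V) :=
  σ ((List.range (k + 1)).map c)

/-- In the `(m : q)` Connector-Breaker game on the edges of `G`, with Connector moving first,
Breaker has a strategy (whose moves are always legal) such that however Connector plays, some
vertex stays isolated in Connector's graph throughout the game. Claiming no edge is a permitted
move, so a play that ends early continues with empty moves. -/
def BreakerCanIsolate (G : SimpleGraph V) (m q : ℕ) : Prop :=
  ∃ σ : BreakerStrategy V, ∀ c : ℕ → Set (Sym2 V),
    ConnectorLegal G m c (σ.response c) →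
      BreakerLegal G q c (σ.response c) ∧ ∃ x : V, ∀ k, (graphAfter c k).IsIsolated x

end ConnectorBreaker

/-!
Fix a vertex `x`. Call a vertex *hot*, relative to Connector's vertex set `S`, if it is infected by
bootstrap percolation with threshold `2` in `G - S` that starts from `x` and its neighbours. Breaker
always claims all free edges from `S` to hot vertices. Since `x` itself is hot, Connector never
reaches `x` as long as this takes at most two edges per round (`encard_hotCut_sdiff_le`). A vertex
that Connector enters through an edge Breaker left her is not hot, so it has at most one hot
neighbour. Two such vertices cost Breaker two edges. The only other possibility is that her second
vertex in the round is the hot neighbour of the first, and then its own hot neighbours are all that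
Breaker has to cut off, so it must not have more than two of them.

That is where the density of the random graph enters. For `p ≤ n ^ (-2/3 - ε)` and a bounded set
`R` of roots, a first moment computation (`binomialRandom_not_sparse_le`) shows that with high
probability every bounded vertex set `Y` has predimension `3 |Y \ R| - 2 e(Y)` at least a fixed
proportion of `e(Y)`. In such a graph each hot vertex lies in a set of predimension at most `1`
over `x`, which then has bounded size (`exists_witness`). A vertex with three hot neighbours would
complete three of these sets to one of predimension at most `3 + 3 - 6 = 0` that contains edges,
which is impossible (`hot_neighbours_not_three`).

It remains to find an `x` for which Connector's first nonempty move, with its at most four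
vertices, creates no threat at all. Breaker picks it among `17` roots after having seen that move:
the vertices of the move have predimension at most `12`, and each of the `13` or more other roots
that is threatened provides a further set that lowers the predimension by at least `1`
(`exists_root_hotCut_eq_empty`).
-/

namespace ConnectorBreaker

/-! ### Sparse graphs and the predimension -/

section Sparse

variable {V : Type*} (G : SimpleGraph V)

open Classical in
/-- The edges of `G` inside the finite vertex set `Y`. -/
noncomputable def edgesIn (Y : Finset V) : Finset (Sym2 V) :=
  Y.sym2.filter (· ∈ G.edgeSet)

variable {G}

lemma mk_mem_edgesIn {Y : Finset V} {u v : V} :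
    s(u, v) ∈ edgesIn G Y ↔ G.Adj u v ∧ u ∈ Y ∧ v ∈ Y := by
  simp [edgesIn, and_comm]

lemma edgesIn_mono {Y Z : Finset V} (h : Y ⊆ Z) : edgesIn G Y ⊆ edgesIn G Z := by
  intro e
  induction e with
  | _ u v => simp only [mk_mem_edgesIn]; exact fun ⟨h1, h2, h3⟩ => ⟨h1, h h2, h h3⟩

variable (G) [DecidableEq V]

/-- The rooted predimension `3 |Y \ R| - 2 e(Y)` of a finite vertex set `Y`: the vertices in the
set `R` of roots are free of charge. In a random graph of density `n ^ (-2/3)`, about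
`n ^ (predim G R Y / 3)` copies of the rooted graph on `Y` are expected. -/
noncomputable def predim (R Y : Finset V) : ℤ :=
  3 * ((Y \ R).card : ℤ) - 2 * ((edgesIn G Y).card : ℤ)

/-- All vertex sets of size at most `K` have nonnegative predimension over `R`, and even one that
is at least a fixed proportion `1 / N` of their number of edges. -/
def Sparse (R : Finset V) (N K : ℕ) : Prop :=
  ∀ Y : Finset V, Y.card ≤ K → ((edgesIn G Y).card : ℤ) ≤ N * predim G R Y

variable {G}

lemma edgesIn_inter (A B : Finset V) : edgesIn G (A ∩ B) = edgesIn G A ∩ edgesIn G B := by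
  ext e
  induction e with
  | _ u v => simp only [mk_mem_edgesIn, Finset.mem_inter]; tauto

lemma edgesIn_union_subset (A B : Finset V) : edgesIn G A ∪ edgesIn G B ⊆ edgesIn G (A ∪ B) :=
  Finset.union_subset (edgesIn_mono Finset.subset_union_left)
    (edgesIn_mono Finset.subset_union_right)

lemma card_edgesIn_add_le (A B : Finset V) :
    (edgesIn G A).card + (edgesIn G B).card ≤
      (edgesIn G (A ∪ B)).card + (edgesIn G (A ∩ B)).card := by
  rw [edgesIn_inter, ← Finset.card_union_add_card_inter]
  have := Finset.card_le_card (edgesIn_union_subset (G := G) A B)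
  omega

/-- An edge between `A \ B` and `B \ A` makes the supermodular inequality strict. -/
lemma card_edgesIn_add_lt {A B : Finset V} {u v : V} (h : G.Adj u v) (huA : u ∈ A) (huB : u ∉ B)
    (hvA : v ∉ A) (hvB : v ∈ B) :
    (edgesIn G A).card + (edgesIn G B).card + 1 ≤
      (edgesIn G (A ∪ B)).card + (edgesIn G (A ∩ B)).card := by
  rw [edgesIn_inter, ← Finset.card_union_add_card_inter]
  have hn : s(u, v) ∉ edgesIn G A ∪ edgesIn G B := by
    simp [mk_mem_edgesIn, huB, hvA]
  have hs : insert s(u, v) (edgesIn G A ∪ edgesIn G B) ⊆ edgesIn G (A ∪ B) := by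
    apply Finset.insert_subset _ (edgesIn_union_subset A B)
    simp [mk_mem_edgesIn, h, huA, hvB]
  have := Finset.card_le_card hs
  rw [Finset.card_insert_of_notMem hn] at this
  omega

lemma card_edgesIn_insert {Y T : Finset V} {v : V} (hv : v ∉ Y) (hT : T ⊆ Y)
    (hadj : ∀ t ∈ T, G.Adj v t) :
    (edgesIn G Y).card + T.card ≤ (edgesIn G (insert v Y)).card := by
  have hinj : Set.InjOn (fun t => s(v, t)) T := fun a _ b _ h => Sym2.congr_right.1 h
  rw [← Finset.card_image_of_injOn hinj, ← Finset.card_union_of_disjoint]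
  · apply Finset.card_le_card
    refine Finset.union_subset (edgesIn_mono (Finset.subset_insert v Y)) ?_
    intro e he
    obtain ⟨t, ht, rfl⟩ := Finset.mem_image.1 he
    simp [mk_mem_edgesIn, hadj t ht, hT ht]
  · rw [Finset.disjoint_right]
    intro e he
    obtain ⟨t, ht, rfl⟩ := Finset.mem_image.1 he
    simp [mk_mem_edgesIn, hv]

lemma predim_insert_le {R Y T : Finset V} {v : V} (hv : v ∉ Y) (hT : T ⊆ Y)
    (hadj : ∀ t ∈ T, G.Adj v t) :
    predim G R (insert v Y) ≤ predim G R Y + 3 - 2 * T.card := by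
  have h1 := card_edgesIn_insert hv hT hadj
  have h2 : (insert v Y \ R).card ≤ (Y \ R).card + 1 :=
    (Finset.card_le_card (by grind)).trans (Finset.card_insert_le v (Y \ R))
  unfold predim
  omega

lemma predim_insert_root_le {R Y T : Finset V} {v : V} (hv : v ∉ Y) (hR : v ∈ R) (hT : T ⊆ Y)
    (hadj : ∀ t ∈ T, G.Adj v t) :
    predim G R (insert v Y) ≤ predim G R Y - 2 * T.card := by
  have h1 := card_edgesIn_insert hv hT hadj
  have h2 : insert v Y \ R = Y \ R := Finset.insert_sdiff_of_mem _ hR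
  unfold predim
  rw [h2]
  omega

lemma card_sdiff_modular (A B R : Finset V) :
    ((A ∪ B) \ R).card + ((A ∩ B) \ R).card = (A \ R).card + (B \ R).card := by
  rw [← Finset.card_union_add_card_inter (A \ R), Finset.union_sdiff_distrib]
  congr 2
  grind

lemma predim_submodular (R A B : Finset V) :
    predim G R (A ∪ B) + predim G R (A ∩ B) ≤ predim G R A + predim G R B := by
  have h1 := card_edgesIn_add_le (G := G) A B
  have h2 := card_sdiff_modular A B R
  unfold predim
  omega

lemma predim_submodular_of_adj (R : Finset V) {A B : Finset V} {u v : V} (h : G.Adj u v)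
    (huA : u ∈ A) (huB : u ∉ B) (hvA : v ∉ A) (hvB : v ∈ B) :
    predim G R (A ∪ B) + predim G R (A ∩ B) + 2 ≤ predim G R A + predim G R B := by
  have h1 := card_edgesIn_add_lt h huA huB hvA hvB
  have h2 := card_sdiff_modular A B R
  unfold predim
  omega

lemma predim_anti {R S : Finset V} (h : R ⊆ S) (Y : Finset V) : predim G S Y ≤ predim G R Y := by
  have := Finset.card_le_card (Finset.sdiff_subset_sdiff (Finset.Subset.refl Y) h)
  unfold predim
  omega

lemma Sparse.mono_roots {R S : Finset V} {N K : ℕ} (h : Sparse G S N K) (hRS : R ⊆ S) :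
    Sparse G R N K := fun Y hY =>
  (h Y hY).trans (mul_le_mul_of_nonneg_left (predim_anti hRS Y) (by positivity))

lemma Sparse.predim_nonneg {R : Finset V} {N K : ℕ} (h : Sparse G R N K) (hN : 1 ≤ N)
    {Y : Finset V} (hY : Y.card ≤ K) : 0 ≤ predim G R Y := by
  have h1 := h Y hY
  by_contra hlt
  have : (N : ℤ) * predim G R Y < 0 := mul_neg_of_pos_of_neg (by exact_mod_cast hN) (by omega)
  omega

/-- Sets of predimension at most `1` over a single root have bounded size. -/
lemma Sparse.card_le {x : V} {N K : ℕ} (h : Sparse G {x} N K) (hN : 1 ≤ N)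
    {Y : Finset V} (hY : Y.card ≤ K) (h1 : predim G {x} Y ≤ 1) : Y.card ≤ N + 1 := by
  have h2 := h Y hY
  have h3 : (N : ℤ) * predim G {x} Y ≤ N := by nlinarith
  have h4 : Y.card ≤ (Y \ {x}).card + 1 := by
    have := Finset.le_card_sdiff {x} Y
    simp at this
    omega
  unfold predim at h1 h2 h3
  omega

end Sparse

/-! ### Hot vertices -/

section Hot

variable {V : Type*} (G : SimpleGraph V)

/-- The vertices which bootstrap percolation with threshold `2` in `G - C`, started from `x` and
its neighbours, infects within `k` steps. -/
def hotWithin (x : V) (C : Set V) : ℕ → Set V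
  | 0 => {v | v ∉ C ∧ (v = x ∨ G.Adj v x)}
  | k + 1 => hotWithin x C k ∪
      {v | v ∉ C ∧ ∃ a ∈ hotWithin x C k, ∃ b ∈ hotWithin x C k, a ≠ b ∧ G.Adj v a ∧ G.Adj v b}

/-- The hot vertices: those infected by bootstrap percolation with threshold `2` in `G - C`,
started from `x` and its neighbours. -/
def hot (x : V) (C : Set V) : Set V := ⋃ k, hotWithin G x C k

/-- The edges of `G` that lead from `S` to a vertex which is hot with respect to `x` outside
`S`. -/
def hotCut (x : V) (S : Set V) : Set (Sym2 V) :=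
  {e | ∃ u ∈ S, ∃ a ∈ hot G x S, G.Adj u a ∧ e = s(u, a)}

variable {G} {x : V}

lemma hotWithin_succ_subset (C : Set V) (k : ℕ) : hotWithin G x C k ⊆ hotWithin G x C (k + 1) :=
  Set.subset_union_left

lemma hotWithin_mono (C : Set V) : Monotone (hotWithin G x C) :=
  monotone_nat_of_le_succ (hotWithin_succ_subset C)

lemma notMem_of_mem_hotWithin {C : Set V} {k : ℕ} {a : V} (h : a ∈ hotWithin G x C k) :
    a ∉ C := by
  induction k with
  | zero => exact h.1
  | succ k ih => exact h.elim ih (fun h => h.1)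

lemma notMem_of_mem_hot {C : Set V} {a : V} (h : a ∈ hot G x C) : a ∉ C := by
  obtain ⟨k, hk⟩ := Set.mem_iUnion.1 h
  exact notMem_of_mem_hotWithin hk

lemma hotWithin_anti {C D : Set V} (h : C ⊆ D) (k : ℕ) :
    hotWithin G x D k ⊆ hotWithin G x C k := by
  induction k with
  | zero => exact fun v hv => ⟨fun hc => hv.1 (h hc), hv.2⟩
  | succ k ih =>
    rintro v (hv | ⟨hvD, a, ha, b, hb, hr⟩)
    · exact Or.inl (ih hv)
    · exact Or.inr ⟨fun hc => hvD (h hc), a, ih ha, b, ih hb, hr⟩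

lemma hot_anti {C D : Set V} (h : C ⊆ D) : hot G x D ⊆ hot G x C :=
  Set.iUnion_mono (hotWithin_anti h)

lemma self_mem_hotWithin {C : Set V} (hx : x ∉ C) (k : ℕ) : x ∈ hotWithin G x C k :=
  hotWithin_mono C (Nat.zero_le k) ⟨hx, Or.inl rfl⟩

lemma self_mem_hot {C : Set V} (hx : x ∉ C) : x ∈ hot G x C :=
  Set.mem_iUnion.2 ⟨0, self_mem_hotWithin hx 0⟩

lemma mem_hot_of_adj {C : Set V} {v : V} (hv : v ∉ C) (h : G.Adj v x) : v ∈ hot G x C :=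
  Set.mem_iUnion.2 ⟨0, hv, Or.inr h⟩

/-- A vertex with two hot neighbours is hot. -/
lemma mem_hot_of_adj_adj {C : Set V} {v a b : V} (hv : v ∉ C) (ha : a ∈ hot G x C)
    (hb : b ∈ hot G x C) (hab : a ≠ b) (hva : G.Adj v a) (hvb : G.Adj v b) : v ∈ hot G x C := by
  obtain ⟨k, hk⟩ := Set.mem_iUnion.1 ha
  obtain ⟨l, hl⟩ := Set.mem_iUnion.1 hb
  exact Set.mem_iUnion.2 ⟨max k l + 1, Or.inr ⟨hv, a, hotWithin_mono C (le_max_left k l) hk, b,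
    hotWithin_mono C (le_max_right k l) hl, hab, hva, hvb⟩⟩

variable [DecidableEq V]

/-- In a sparse graph every hot vertex lies in a set of bounded size and of predimension at most
`1` over `x`. A neighbour of `x` contributes `3 - 2 = 1`; a later vertex merges two such sets and
has two edges to them, which makes `1 + 1 + 3 - 4 = 1` again, and sparsity keeps the size
bounded. -/
lemma exists_witness {N K : ℕ} (hs : Sparse G {x} N K) (hN : 1 ≤ N) (hK : 2 * N + 3 ≤ K)
    {C : Set V} (hx : x ∉ C) (k : ℕ) {a : V} (ha : a ∈ hotWithin G x C k) :
    ∃ X : Finset V, x ∈ X ∧ a ∈ X ∧ (X : Set V) ⊆ hotWithin G x C k ∧ X.card ≤ N + 1 ∧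
      predim G {x} X ≤ 1 := by
  induction k generalizing a with
  | zero =>
    obtain ⟨haC, rfl | hax⟩ := ha
    · refine ⟨{a}, by simp, by simp, ?_, by simp, ?_⟩
      · simpa using self_mem_hotWithin (k := 0) haC
      · simp only [predim, sdiff_self, Finset.bot_eq_empty, Finset.card_empty]
        omega
    · refine ⟨{a, x}, by simp, by simp, ?_, ?_, ?_⟩
      · simp only [Finset.coe_insert, Finset.coe_singleton, Set.insert_subset_iff,
          Set.singleton_subset_iff]
        exact ⟨⟨haC, Or.inr hax⟩, self_mem_hotWithin hx 0⟩
      · have := Finset.card_le_two (a := a) (b := x)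
        omega
      · have h := predim_insert_le (R := {x}) (Y := {x}) (T := {x}) (v := a)
          (by simpa using hax.ne) (by simp) (by simpa using hax)
        have h0 : predim G {x} {x} ≤ 0 := by
          simp only [predim, sdiff_self, Finset.bot_eq_empty, Finset.card_empty]
          omega
        simp only [Finset.card_singleton] at h
        push_cast at h
        omega
  | succ k ih =>
    by_cases hak : a ∈ hotWithin G x C k
    · obtain ⟨X, h1, h2, h3, h4⟩ := ih hak
      exact ⟨X, h1, h2, h3.trans (hotWithin_succ_subset C k), h4⟩
    obtain hak' | ⟨haC, b, hb, c, hc, hbc, hab, hac⟩ := ha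
    · exact absurd hak' hak
    obtain ⟨X, hxX, hbX, hXh, hXc, hXp⟩ := ih hb
    obtain ⟨Y, hxY, hcY, hYh, hYc, hYp⟩ := ih hc
    have hsub : ((X ∪ Y : Finset V) : Set V) ⊆ hotWithin G x C k := by
      simpa using ⟨hXh, hYh⟩
    have haXY : a ∉ X ∪ Y := fun h => hak (hsub h)
    have hle : predim G {x} (insert a (X ∪ Y)) ≤ 1 := by
      have h := predim_insert_le (G := G) (R := {x}) (T := {b, c}) haXY
        (by simp [Finset.insert_subset_iff, hbX, hcY]) (by simp [hab, hac])
      have h2 := predim_submodular (G := G) {x} X Y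
      have h3 := hs.predim_nonneg hN (Y := X ∩ Y)
        ((Finset.card_le_card Finset.inter_subset_left).trans (by omega))
      rw [Finset.card_pair hbc] at h
      push_cast at h
      omega
    have hcard : (insert a (X ∪ Y)).card ≤ K := by
      have h1 := Finset.card_insert_le a (X ∪ Y)
      have h2 := Finset.card_union_le X Y
      omega
    refine ⟨insert a (X ∪ Y), by simp [hxX], by simp, ?_, hs.card_le hN hcard hle, hle⟩
    rw [Finset.coe_insert, Set.insert_subset_iff]
    exact ⟨Or.inr ⟨haC, b, hb, c, hc, hbc, hab, hac⟩, hsub.trans (hotWithin_succ_subset C k)⟩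

lemma exists_witness_of_mem_hot {N K : ℕ} (hs : Sparse G {x} N K) (hN : 1 ≤ N)
    (hK : 2 * N + 3 ≤ K) {C : Set V} (hx : x ∉ C) {a : V} (ha : a ∈ hot G x C) :
    ∃ X : Finset V, a ∈ X ∧ (∀ v ∈ X, v ∉ C) ∧ X.card ≤ N + 1 ∧ predim G {x} X ≤ 1 := by
  obtain ⟨k, hk⟩ := Set.mem_iUnion.1 ha
  obtain ⟨X, -, h2, h3, h4, h5⟩ := exists_witness hs hN hK hx k hk
  exact ⟨X, h2, fun v hv => notMem_of_mem_hotWithin (h3 hv), h4, h5⟩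

/-- In a sparse graph no vertex of `C` has three neighbours that are hot outside `C`: it would
complete their witnesses to a set of predimension at most `3 + 3 - 6 = 0` which contains edges. -/
lemma hot_neighbours_not_three {N K : ℕ} (hs : Sparse G {x} N K) (hN : 1 ≤ N)
    (hK : 3 * N + 4 ≤ K) {C : Set V} (hx : x ∉ C) {v : V} (hv : v ∈ C) {T : Finset V}
    (hT : ∀ t ∈ T, t ∈ hot G x C ∧ G.Adj v t) : T.card ≤ 2 := by
  by_contra hcon
  obtain ⟨a, ha, b, hb, c, hc, hab, hac, hbc⟩ := Finset.two_lt_card.1 (not_le.1 hcon)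
  obtain ⟨A, haA, hAC, hAc, hAp⟩ := exists_witness_of_mem_hot hs hN (by omega) hx (hT a ha).1
  obtain ⟨B, hbB, hBC, hBc, hBp⟩ := exists_witness_of_mem_hot hs hN (by omega) hx (hT b hb).1
  obtain ⟨D, hcD, hDC, hDc, hDp⟩ := exists_witness_of_mem_hot hs hN (by omega) hx (hT c hc).1
  have hcAB := Finset.card_union_le A B
  have hcABD := Finset.card_union_le (A ∪ B) D
  have hvn : v ∉ A ∪ B ∪ D := by
    simp only [Finset.mem_union, not_or]
    exact ⟨⟨fun h => hAC v h hv, fun h => hBC v h hv⟩, fun h => hDC v h hv⟩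
  have hTsub : ({a, b, c} : Finset V) ⊆ A ∪ B ∪ D := by
    simp [Finset.insert_subset_iff, haA, hbB, hcD]
  have hTadj : ∀ t ∈ ({a, b, c} : Finset V), G.Adj v t := by
    simp [(hT a ha).2, (hT b hb).2, (hT c hc).2]
  have hT3 : ({a, b, c} : Finset V).card = 3 := Finset.card_eq_three.2 ⟨a, b, c, hab, hac, hbc, rfl⟩
  have h1 := predim_insert_le (R := {x}) hvn hTsub hTadj
  have h2 := card_edgesIn_insert hvn hTsub hTadj
  have h3 := predim_submodular (G := G) {x} A B
  have h4 := predim_submodular (G := G) {x} (A ∪ B) D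
  have h5 := hs.predim_nonneg hN (Y := A ∩ B)
    ((Finset.card_le_card Finset.inter_subset_left).trans (by omega))
  have h6 := hs.predim_nonneg hN (Y := (A ∪ B) ∩ D)
    ((Finset.card_le_card Finset.inter_subset_right).trans (by omega))
  have h7 : (insert v (A ∪ B ∪ D)).card ≤ K := (Finset.card_insert_le _ _).trans (by omega)
  have h8 := hs _ h7
  rw [hT3] at h1 h2
  have h9 : (N : ℤ) * predim G {x} (insert v (A ∪ B ∪ D)) ≤ 0 :=
    mul_nonpos_of_nonneg_of_nonpos (by positivity) (by push_cast at h1; omega)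
  omega

end Hot

/-! ### Choosing the vertex to be isolated -/

section Roots

variable {V : Type*} [DecidableEq V] {G : SimpleGraph V}

/-- Let `Y` be joined by an edge `u a` to a vertex `a ∉ Y` that is hot with respect to the root
`x`, where `u` does not serve to infect `a`. Adding a witness for `a` to `Y` costs at most `1`, and
the edge gains `2`. -/
lemma exists_predim_le_sub_one_of_notMem {R : Finset V} {N K : ℕ} (hs : Sparse G R N K)
    (hN : 1 ≤ N) (hK : 2 * N + 3 ≤ K) {C : Set V} {x : V} (hxR : x ∈ R) (hxC : x ∉ C)
    {Y : Finset V} (hY : Y.card ≤ K) {k : ℕ} {u a : V} (hu : u ∈ Y) (hua : G.Adj u a)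
    (hak : a ∈ hotWithin G x C k) (huk : u ∉ hotWithin G x C k) (haY : a ∉ Y) :
    ∃ Z : Finset V, Y ⊆ Z ∧ Z.card ≤ Y.card + (N + 1) ∧ Z ∩ R ⊆ insert x (Y ∩ R) ∧
      predim G R Z ≤ predim G R Y - 1 := by
  have hxR' : {x} ⊆ R := by simpa using hxR
  obtain ⟨X, hxX, haX, hXh, hXc, hXp⟩ :=
    exists_witness (hs.mono_roots hxR') hN hK hxC k hak
  have huX : u ∉ X := fun h => huk (hXh h)
  have hsub := predim_submodular_of_adj R hua hu huX haY haX
  have hint := hs.predim_nonneg hN (Y := Y ∩ X)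
    ((Finset.card_le_card Finset.inter_subset_left).trans hY)
  have hXR := predim_anti (G := G) hxR' X
  refine ⟨Y ∪ X, Finset.subset_union_left, (Finset.card_union_le Y X).trans (by omega), ?_,
    by omega⟩
  -- A second root in `X` would make the predimension of `X` over `R` negative.
  intro y hy
  rw [Finset.mem_inter, Finset.mem_union] at hy
  obtain ⟨hyY | hyX, hyR⟩ := hy
  · simp [hyY, hyR]
  by_contra hyn
  have hyx : y ≠ x := by rintro rfl; simp at hyn
  have hlt : (X \ R).card < (X \ {x}).card := by
    apply Finset.card_lt_card
    rw [Finset.ssubset_iff_of_subset (Finset.sdiff_subset_sdiff subset_rfl hxR')]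
    exact ⟨y, by simp [hyX, hyx], by simp [hyR]⟩
  have hpos := hs.predim_nonneg hN (Y := X) (by omega)
  unfold predim at hpos hXp
  omega

/-- If a set `Y` is linked to a vertex that is hot with respect to the root `x ∉ Y`, then its
predimension drops by at least `1` when `x` and the vertices responsible for the link are added. -/
lemma exists_predim_le_sub_one {R : Finset V} {N K : ℕ} (hs : Sparse G R N K) (hN : 1 ≤ N)
    (hK : 2 * N + 3 ≤ K) {C : Set V} {x : V} (hxR : x ∈ R) (hxC : x ∉ C) {Y : Finset V}
    (hxY : x ∉ Y) (hY : Y.card ≤ K) (k : ℕ) {u a : V} (hu : u ∈ Y) (hua : G.Adj u a)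
    (hak : a ∈ hotWithin G x C k) (huk : u ∉ hotWithin G x C k) :
    ∃ Z : Finset V, Y ⊆ Z ∧ Z.card ≤ Y.card + (N + 1) ∧ Z ∩ R ⊆ insert x (Y ∩ R) ∧
      predim G R Z ≤ predim G R Y - 1 := by
  by_cases haY : a ∉ Y
  · exact exists_predim_le_sub_one_of_notMem hs hN hK hxR hxC hY hu hua hak huk haY
  rw [not_not] at haY
  -- Otherwise the infection path from `a` towards `x` is followed until it leaves `Y`.
  induction k generalizing u a with
  | zero =>
    obtain ⟨-, rfl | hax⟩ := hak
    · exact absurd haY hxY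
    refine ⟨insert x Y, Finset.subset_insert _ _, ?_, ?_, ?_⟩
    · exact (Finset.card_insert_le _ _).trans (by omega)
    · rw [Finset.insert_inter_of_mem hxR]
    · have h := predim_insert_root_le (R := R) (T := {a}) hxY hxR (by simpa using haY)
        (by simpa using hax.symm)
      rw [Finset.card_singleton] at h
      push_cast at h
      omega
  | succ k ih =>
    have huk' : u ∉ hotWithin G x C k := fun h => huk (hotWithin_succ_subset C k h)
    by_cases hak' : a ∈ hotWithin G x C k
    · exact ih hu hua hak' huk' haY
    obtain hak'' | ⟨-, b, hb, -, -, -, hab, -⟩ := hak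
    · exact absurd hak'' hak'
    by_cases hbY : b ∈ Y
    · exact ih haY hab hb hak' hbY
    · exact exists_predim_le_sub_one_of_notMem hs hN hK hxR hxC hY haY hab hb hak' hbY

/-- Among `17` roots of a sparse graph there is one outside `C` such that no vertex of `C` has a
neighbour that is hot with respect to it, provided that `C` has at most four vertices: `C` has
predimension at most `12`, and each of the `13` roots outside `C` that fails lowers it by `1`. -/
lemma exists_root_hotCut_eq_empty {R : Finset V} {N K : ℕ} (hs : Sparse G R N K) (hN : 1 ≤ N)
    (hR : 17 ≤ R.card) (hK : 4 + 13 * (N + 1) ≤ K) {C : Finset V} (hC : C.card ≤ 4) :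
    ∃ x ∈ R, x ∉ C ∧ hotCut G x (C : Set V) = ∅ := by
  by_contra! hcon
  have key : ∀ S : Finset V, S ⊆ R \ C → S.card ≤ 13 →
      ∃ Y : Finset V, C ⊆ Y ∧ Y.card ≤ 4 + S.card * (N + 1) ∧ Y ∩ R ⊆ C ∪ S ∧
        predim G R Y ≤ 12 - S.card := by
    intro S
    induction S using Finset.induction_on with
    | empty =>
      intro _ _
      refine ⟨C, subset_rfl, by simpa using hC, by simp, ?_⟩
      have := Finset.card_le_card (Finset.sdiff_subset : C \ R ⊆ C)
      simp only [predim, Finset.card_empty]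
      omega
    | insert x S hxS ih =>
      intro hS hcard
      rw [Finset.card_insert_of_notMem hxS] at hcard ⊢
      obtain ⟨Y, hCY, hYc, hYR, hYp⟩ := ih ((Finset.subset_insert x S).trans hS) (by omega)
      obtain ⟨hxR, hxC⟩ := Finset.mem_sdiff.1 (hS (Finset.mem_insert_self x S))
      have hxY : x ∉ Y := by
        intro h
        have := hYR (Finset.mem_inter.2 ⟨h, hxR⟩)
        simp [hxC, hxS] at this
      obtain ⟨e, u, hu, a, ha, hua, -⟩ := hcon x hxR hxC
      obtain ⟨k, hk⟩ := Set.mem_iUnion.1 ha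
      have hYK : Y.card ≤ K := by nlinarith
      obtain ⟨Z, hYZ, hZc, hZR, hZp⟩ := exists_predim_le_sub_one hs hN (by omega) hxR
        (by simpa using hxC) hxY hYK k (hCY hu) hua hk (fun h => notMem_of_mem_hotWithin h hu)
      refine ⟨Z, hCY.trans hYZ, by linarith, hZR.trans ?_, by push_cast; omega⟩
      rw [Finset.union_insert]
      exact Finset.insert_subset_insert x hYR
  have h13 : 13 ≤ (R \ C).card := by
    have := Finset.le_card_sdiff C R
    omega
  obtain ⟨S, hSR, hS13⟩ := Finset.exists_subset_card_eq h13
  obtain ⟨Y, -, hYc, -, hYp⟩ := key S hSR hS13.le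
  rw [hS13] at hYc hYp
  have := hs.predim_nonneg hN (Y := Y) (by omega)
  omega

end Roots

/-! ### One round of the game -/

section Round

variable {V : Type*} {G : SimpleGraph V} {x : V}

lemma hotCut_empty : hotCut G x ∅ = ∅ := by
  simp [hotCut]

/-- A round of the game. Before it, all edges from Connector's vertex set `S` to hot vertices are
in the set `F` of Breaker's edges, and Connector enters `v₁` and then `v₂` through edges outside
`F`. The vertex `v₁` is not hot, so it has at most one hot neighbour, and the same holds for `v₂`
unless `v₂` itself is that neighbour of `v₁`; in that case `v₂` has at most two hot neighbours by
sparsity. So there are at most two new edges to hot vertices. -/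
lemma encard_hotCut_sdiff_le [DecidableEq V] {N K : ℕ} (hs : Sparse G {x} N K) (hN : 1 ≤ N)
    (hK : 3 * N + 4 ≤ K) {S : Set V} {F : Set (Sym2 V)} (hxS : x ∉ S) (hF : hotCut G x S ⊆ F)
    {u₁ v₁ u₂ v₂ : V} (hu₁ : u₁ ∈ S) (h₁ : G.Adj u₁ v₁) (h₁F : s(u₁, v₁) ∉ F)
    (hu₂ : u₂ ∈ insert v₁ S) (h₂ : G.Adj u₂ v₂) (h₂F : s(u₂, v₂) ∉ F) :
    x ∉ insert v₂ (insert v₁ S) ∧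
      (hotCut G x (insert v₂ (insert v₁ S)) \ F).encard ≤ 2 := by
  set S' : Set V := insert v₂ (insert v₁ S) with hS'
  have hSS' : S ⊆ S' := (Set.subset_insert _ _).trans (Set.subset_insert _ _)
  have hclosed : ∀ w ∈ S, ∀ a ∈ hot G x S, G.Adj w a → s(w, a) ∈ F :=
    fun w hw a ha hwa => hF ⟨w, hw, a, ha, hwa, rfl⟩
  have hxhot : x ∈ hot G x S := self_mem_hot hxS
  have hv₁ : v₁ ∉ hot G x S := fun h => h₁F (hclosed u₁ hu₁ v₁ h h₁)
  have hone : ∀ w ∉ hot G x S, ∀ a ∈ hot G x S, ∀ b ∈ hot G x S, G.Adj w a → G.Adj w b →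
      s(w, a) ∉ F → a = b := by
    intro w hw a ha b hb hwa hwb hwaF
    by_contra hab
    exact hw (mem_hot_of_adj_adj (fun h => hwaF (hclosed w h a ha hwa)) ha hb hab hwa hwb)
  by_cases hv₂ : v₂ ∈ hot G x S
  · obtain rfl | hu₂S := hu₂
    swap
    · exact absurd (hclosed u₂ hu₂S v₂ hv₂ h₂) h₂F
    have hx' : x ∉ S' := by
      rintro (rfl | rfl | h)
      · exact hv₁ (mem_hot_of_adj (fun h => h₂F (hclosed u₂ h x hxhot h₂)) h₂)
      · exact hv₁ hxhot
      · exact hxS h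
    refine ⟨hx', ?_⟩
    have hsub : hotCut G x S' \ F ⊆ (fun a => s(v₂, a)) '' {a | a ∈ hot G x S' ∧ G.Adj v₂ a} := by
      rintro e ⟨⟨w, hw, a, ha, hwa, rfl⟩, heF⟩
      obtain rfl | rfl | hwS := hw
      · exact ⟨a, ⟨ha, hwa⟩, rfl⟩
      · have hav₂ := hone w hv₁ a (hot_anti hSS' ha) v₂ hv₂ hwa h₂ heF
        exact absurd (show a ∈ S' from Or.inl hav₂) (notMem_of_mem_hot ha)
      · exact absurd (hclosed w hwS a (hot_anti hSS' ha) hwa) heF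
    refine (Set.encard_le_encard hsub).trans ((Set.encard_image_le _ _).trans ?_)
    by_contra hcon
    obtain ⟨T, hT, hT3⟩ := Set.exists_subset_encard_eq
      (Order.add_one_le_of_lt (not_le.1 hcon))
    have hfin : T.Finite := Set.finite_of_encard_eq_coe (k := 3) (by rw [hT3]; norm_num)
    have h2 := hot_neighbours_not_three hs hN hK hx' (Set.mem_insert v₂ _) (T := hfin.toFinset)
      (fun t ht => hT (by simpa using ht))
    rw [hfin.encard_eq_coe_toFinset_card] at hT3
    have h3 : hfin.toFinset.card = 3 := by exact_mod_cast hT3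
    omega
  · refine ⟨?_, ?_⟩
    · rintro (rfl | rfl | h)
      · exact hv₂ hxhot
      · exact hv₁ hxhot
      · exact hxS h
    have hsub : hotCut G x S' \ F ⊆
        (fun a => s(v₁, a)) '' {a | a ∈ hot G x S ∧ G.Adj v₁ a ∧ s(v₁, a) ∉ F} ∪
        (fun a => s(v₂, a)) '' {a | a ∈ hot G x S ∧ G.Adj v₂ a ∧ s(v₂, a) ∉ F} := by
      rintro e ⟨⟨w, hw, a, ha, hwa, rfl⟩, heF⟩
      have ha' := hot_anti hSS' ha
      obtain rfl | rfl | hwS := hw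
      · exact Or.inr ⟨a, ⟨ha', hwa, heF⟩, rfl⟩
      · exact Or.inl ⟨a, ⟨ha', hwa, heF⟩, rfl⟩
      · exact absurd (hclosed w hwS a ha' hwa) heF
    have hle : ∀ w ∉ hot G x S, ((fun a => s(w, a)) ''
        {a | a ∈ hot G x S ∧ G.Adj w a ∧ s(w, a) ∉ F}).encard ≤ 1 := by
      intro w hw
      refine (Set.encard_image_le _ _).trans (Set.encard_le_one_iff.2 ?_)
      exact fun a b ha hb => hone w hw a ha.1 b hb.1 ha.2.1 hb.2.1 ha.2.2
    calc _ ≤ _ := Set.encard_le_encard hsub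
      _ ≤ _ := Set.encard_union_le _ _
      _ ≤ 1 + 1 := add_le_add (hle v₁ hv₁) (hle v₂ hv₂)
      _ = 2 := one_add_one_eq_two

end Round

/-! ### Moves and strategies -/

section Moves

variable {V : Type*}

lemma mem_claimed_succ {move : ℕ → Set (Sym2 V)} {k : ℕ} {e : Sym2 V} :
    e ∈ claimed move (k + 1) ↔ e ∈ claimed move k ∨ e ∈ move k := by
  simp only [claimed, Set.mem_ofPred_eq, Nat.lt_succ_iff_lt_or_eq, or_and_right, exists_or,
    exists_eq_left]

lemma graphAfter_succ_adj {c : ℕ → Set (Sym2 V)} {k : ℕ} {u v : V} :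
    (graphAfter c (k + 1)).Adj u v ↔ (graphAfter c k).Adj u v ∨ s(u, v) ∈ c k ∧ u ≠ v := by
  simp only [graphAfter, SimpleGraph.fromEdgeSet_adj, mem_claimed_succ, or_and_right]

lemma eq_empty_or_singleton_or_pair {α : Type*} {M : Set α} (hM : M.encard ≤ 2) :
    M = ∅ ∨ ∃ a b, M = {a, b} := by
  obtain h | h := hM.lt_or_eq
  · rw [← one_add_one_eq_two] at h
    obtain h | ⟨a, h⟩ := Set.encard_le_one_iff_eq.1 (Order.le_of_lt_add_one h)
    · exact Or.inl h
    · exact Or.inr ⟨a, a, by simpa using h⟩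
  · obtain ⟨a, b, -, h⟩ := Set.encard_eq_two.1 h
    exact Or.inr ⟨a, b, h⟩

lemma EdgesConnected.support_subset {H : SimpleGraph V} (hH : EdgesConnected H) {W : Set V}
    {s : V} (hs : s ∈ H.support) (hsW : s ∈ W) (hW : ∀ u ∈ W, ∀ v, H.Adj u v → v ∈ W) :
    H.support ⊆ W := by
  intro v hv
  obtain ⟨p⟩ := hH s hs v hv
  induction p with
  | nil => exact hsW
  | cons h p ih => exact ih (H.mem_support.2 ⟨_, h.symm⟩) (hW _ hsW _ h) hv

/-- A legal move of Connector that meets her earlier graph enters at most two new vertices, one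
after the other, each from a vertex she already has. -/
lemma support_graphAfter_succ {c : ℕ → Set (Sym2 V)} {k : ℕ}
    (hdiag : ∀ e ∈ c k, ¬ e.IsDiag) (hcard : (c k).encard ≤ 2)
    (hconn : EdgesConnected (graphAfter c (k + 1))) (hne : (graphAfter c k).support.Nonempty) :
    (graphAfter c (k + 1)).support = (graphAfter c k).support ∨
    ∃ u₁ v₁ u₂ v₂, u₁ ∈ (graphAfter c k).support ∧ s(u₁, v₁) ∈ c k ∧
      u₂ ∈ insert v₁ (graphAfter c k).support ∧ s(u₂, v₂) ∈ c k ∧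
      (graphAfter c (k + 1)).support = insert v₂ (insert v₁ (graphAfter c k).support) := by
  set S := (graphAfter c k).support with hS
  obtain ⟨s, hsS⟩ := hne
  have hmono : S ⊆ (graphAfter c (k + 1)).support := by
    rintro v ⟨w, hw⟩
    exact ⟨w, graphAfter_succ_adj.2 (Or.inl hw)⟩
  have hmem : ∀ u v, s(u, v) ∈ c k → v ∈ (graphAfter c (k + 1)).support :=
    fun u v h => ⟨u, graphAfter_succ_adj.2 (Or.inr ⟨by rwa [Sym2.eq_swap],
      fun h' => hdiag _ h (by simp [h'])⟩)⟩
  -- A set containing `S` that no edge of the move leaves contains all of Connector's vertices.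
  have hsub : ∀ W : Set V, S ⊆ W → (∀ u v, s(u, v) ∈ c k → u ∈ W → v ∈ W) →
      (graphAfter c (k + 1)).support ⊆ W := by
    intro W hSW hW
    refine hconn.support_subset (hmono hsS) (hSW hsS) fun u hu v huv => ?_
    obtain h | h := graphAfter_succ_adj.1 huv
    · exact hSW ⟨u, h.symm⟩
    · exact hW u v h.1 hu
  by_cases h1 : ∃ u v, s(u, v) ∈ c k ∧ u ∈ S ∧ v ∉ S
  swap
  · push Not at h1
    exact Or.inl ((hsub S subset_rfl h1).antisymm hmono)
  obtain ⟨u₁, v₁, he₁, hu₁, hv₁⟩ := h1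
  right
  by_cases h2 : ∃ u v, s(u, v) ∈ c k ∧ u ∈ insert v₁ S ∧ v ∉ insert v₁ S
  · obtain ⟨u₂, v₂, he₂, hu₂, hv₂⟩ := h2
    refine ⟨u₁, v₁, u₂, v₂, hu₁, he₁, hu₂, he₂, (hsub _ ?_ ?_).antisymm ?_⟩
    · exact (Set.subset_insert _ _).trans (Set.subset_insert _ _)
    · have hne : s(u₁, v₁) ≠ s(u₂, v₂) := by
        intro h
        obtain ⟨-, rfl⟩ | ⟨rfl, -⟩ := Sym2.eq_iff.1 h
        · simp at hv₂
        · simp [hu₁] at hv₂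
      -- The two edges found make up the whole move.
      have hpair : ∀ e ∈ c k, e = s(u₁, v₁) ∨ e = s(u₂, v₂) := by
        obtain h | ⟨a, b, h⟩ := eq_empty_or_singleton_or_pair hcard
        · simp [h] at he₁
        · rw [h] at he₁ he₂ ⊢
          simp only [Set.mem_insert_iff, Set.mem_singleton_iff] at he₁ he₂ ⊢
          grind
      intro u v huv hu
      obtain h | h := hpair _ huv
      · obtain ⟨-, rfl⟩ | ⟨-, rfl⟩ := Sym2.eq_iff.1 h <;> simp [hu₁]
      · obtain ⟨-, rfl⟩ | ⟨-, rfl⟩ := Sym2.eq_iff.1 h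
        · simp
        · exact Set.mem_insert_of_mem _ hu₂
    · simp only [Set.insert_subset_iff]
      exact ⟨hmem _ _ he₂, hmem _ _ he₁, hmono⟩
  · push Not at h2
    refine ⟨u₁, v₁, u₁, v₁, hu₁, he₁, Set.mem_insert_of_mem _ hu₁, he₁, ?_⟩
    rw [Set.insert_idem]
    exact (hsub _ (Set.subset_insert _ _) h2).antisymm
      (Set.insert_subset_iff.2 ⟨hmem _ _ he₁, hmono⟩)

/-- The endpoints of at most two edges form a finite set of at most four vertices. -/
lemma exists_finset_support_fromEdgeSet {M : Set (Sym2 V)} (hM : M.encard ≤ 2) :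
    ∃ C : Finset V, C.card ≤ 4 ∧ (SimpleGraph.fromEdgeSet M).support = C := by
  classical
  obtain rfl | ⟨e, f, rfl⟩ := eq_empty_or_singleton_or_pair hM
  · exact ⟨∅, by simp, by simp⟩
  induction e with | _ a b
  induction f with | _ d e
  refine ⟨({a, b, d, e} : Finset V).filter
    (· ∈ (SimpleGraph.fromEdgeSet {s(a, b), s(d, e)}).support), ?_, ?_⟩
  · exact (Finset.card_filter_le _ _).trans Finset.card_le_four
  · ext v
    simp only [Finset.coe_filter, Set.mem_ofPred_eq, iff_and_self, SimpleGraph.mem_support,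
      SimpleGraph.fromEdgeSet_adj]
    rintro ⟨w, hw, -⟩
    simp only [Set.mem_insert_iff, Set.mem_singleton_iff, Sym2.eq_iff] at hw
    simp only [Finset.mem_insert, Finset.mem_singleton]
    tauto

/-- Breaker may describe his moves as a function of Connector's whole sequence of moves, as long as
his `k`-th move depends on her first `k + 1` moves only. -/
lemma exists_strategy (b : (ℕ → Set (Sym2 V)) → ℕ → Set (Sym2 V))
    (hb : ∀ c c' k, (∀ i ≤ k, c i = c' i) → b c k = b c' k) :
    ∃ σ : BreakerStrategy V, ∀ c, σ.response c = b c := by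
  refine ⟨fun l => b (fun i => l.getD i ∅) (l.length - 1), fun c => funext fun k => ?_⟩
  simp only [BreakerStrategy.response, List.length_map, List.length_range, Nat.add_sub_cancel]
  refine hb _ _ k fun i hi => ?_
  simp [List.getD_eq_getElem?_getD, Nat.lt_succ_of_le hi]

end Moves

/-! ### Breaker's strategy -/

section Strategy

variable {V : Type*} (G : SimpleGraph V) (r : Set (Sym2 V) → V)

open Classical in
/-- The vertex that Breaker keeps isolated: `r` applied to the first nonempty move of Connector. -/
noncomputable def target (c : ℕ → Set (Sym2 V)) : V :=
  if h : ∃ j, (c j).Nonempty then r (c (Nat.find h)) else r ∅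

/-- The edges from Connector's vertices after `k + 1` moves to vertices that are hot with respect
to the target. -/
noncomputable def threats (c : ℕ → Set (Sym2 V)) (k : ℕ) : Set (Sym2 V) :=
  hotCut G (target r c) (graphAfter c (k + 1)).support

/-- Breaker claims all threats that were not yet present in earlier rounds. -/
noncomputable def newThreats (c : ℕ → Set (Sym2 V)) (k : ℕ) : Set (Sym2 V) :=
  threats G r c k \ ⋃ j < k, threats G r c j

variable {G r}

lemma claimed_congr {c c' : ℕ → Set (Sym2 V)} {k : ℕ} (h : ∀ i < k, c i = c' i) :
    claimed c k = claimed c' k := by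
  ext e
  simp only [claimed, Set.mem_ofPred_eq]
  exact exists_congr fun i => and_congr_right fun hi => by rw [h i hi]

lemma support_graphAfter_of_empty {c : ℕ → Set (Sym2 V)} {k : ℕ} (h : ∀ i < k, c i = ∅) :
    (graphAfter c k).support = ∅ := by
  have : claimed c k = ∅ := by
    ext e
    simp only [claimed, Set.mem_ofPred_eq, Set.mem_empty_iff_false, iff_false]
    rintro ⟨i, hi, he⟩
    simp [h i hi] at he
  simp [graphAfter, this]

lemma threats_congr {c c' : ℕ → Set (Sym2 V)} {k : ℕ} (h : ∀ i ≤ k, c i = c' i) :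
    threats G r c k = threats G r c' k := by
  have hg : graphAfter c (k + 1) = graphAfter c' (k + 1) := by
    rw [graphAfter, graphAfter, claimed_congr fun i hi => h i (Nat.lt_succ_iff.1 hi)]
  unfold threats
  by_cases hk : ∃ j ≤ k, (c j).Nonempty
  · obtain ⟨j, hjk, hj⟩ := hk
    have hc : ∃ j, (c j).Nonempty := ⟨j, hj⟩
    have hc' : ∃ j, (c' j).Nonempty := ⟨j, h j hjk ▸ hj⟩
    classical
    have hle : Nat.find hc ≤ k := (Nat.find_le hj).trans hjk
    have hfind : Nat.find hc' = Nat.find hc := by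
      refine (Nat.find_eq_iff hc').2 ⟨?_, fun n hn => ?_⟩
      · rw [← h _ hle]
        exact Nat.find_spec hc
      · rw [← h n (hn.le.trans hle)]
        exact Nat.find_min hc hn
    have htarget : target r c = target r c' := by
      simp only [target, dif_pos hc, dif_pos hc']
      convert congrArg r (h _ hle) using 3
    rw [hg, htarget]
  · push Not at hk
    have he : (graphAfter c (k + 1)).support = ∅ :=
      support_graphAfter_of_empty fun i hi => hk i (Nat.lt_succ_iff.1 hi)
    rw [← hg, he, hotCut_empty, hotCut_empty]

lemma newThreats_congr {c c' : ℕ → Set (Sym2 V)} {k : ℕ} (h : ∀ i ≤ k, c i = c' i) :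
    newThreats G r c k = newThreats G r c' k := by
  unfold newThreats
  rw [threats_congr h]
  congr 1
  refine Set.iUnion₂_congr fun j hj => ?_
  exact threats_congr fun i hi => h i (hi.trans hj.le)

lemma claimed_newThreats (c : ℕ → Set (Sym2 V)) (k : ℕ) :
    claimed (newThreats G r c) k = ⋃ j < k, threats G r c j := by
  ext e
  simp only [claimed, Set.mem_ofPred_eq, Set.mem_iUnion, exists_prop]
  constructor
  · rintro ⟨j, hj, he⟩
    exact ⟨j, hj, he.1⟩
  · intro h
    classical
    refine ⟨Nat.find h, (Nat.find_spec h).1, (Nat.find_spec h).2, ?_⟩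
    simp only [Set.mem_iUnion, exists_prop, not_exists, not_and]
    intro j hj he
    exact Nat.find_min h hj ⟨hj.trans (Nat.find_spec h).1, he⟩

lemma hotCut_subset_edgeSet {x : V} {S : Set V} : hotCut G x S ⊆ G.edgeSet := by
  rintro e ⟨u, -, a, -, h, rfl⟩
  exact h

lemma notMem_claimed_of_mem_threats {c : ℕ → Set (Sym2 V)} {k : ℕ} {e : Sym2 V}
    (he : e ∈ threats G r c k) : e ∉ claimed c (k + 1) := by
  obtain ⟨u, hu, a, ha, hua, rfl⟩ := he
  intro h
  refine notMem_of_mem_hot ha (SimpleGraph.mem_support _ |>.2 ⟨u, ?_⟩)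
  rw [graphAfter, SimpleGraph.fromEdgeSet_adj, Sym2.eq_swap]
  exact ⟨h, hua.ne'⟩

/-- In a sparse graph, suppose that `r` assigns to every possible first move of Connector a target
that she does not threaten yet. Then claiming the new threats in each round takes at most two edges
per round and keeps the target isolated. -/
lemma newThreats_correct [DecidableEq V] {N K : ℕ} (hN : 1 ≤ N) (hK : 3 * N + 4 ≤ K)
    (hs : ∀ M, M.encard ≤ 2 → Sparse G {r M} N K)
    (hr : ∀ M, M.encard ≤ 2 → r M ∉ (SimpleGraph.fromEdgeSet M).support ∧
      hotCut G (r M) (SimpleGraph.fromEdgeSet M).support = ∅)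
    {c : ℕ → Set (Sym2 V)} (hc : ConnectorLegal G 2 c (newThreats G r c)) (k : ℕ) :
    target r c ∉ (graphAfter c k).support ∧ (newThreats G r c k).encard ≤ 2 := by
  classical
  have hdiag : ∀ j, ∀ e ∈ c j, ¬ e.IsDiag := fun j e he =>
    G.not_isDiag_of_mem_edgeSet ((hc j).1 he).1
  have hst : Sparse G {target r c} N K := by
    unfold target
    split_ifs with h
    · exact hs _ (hc _).2.1
    · exact hs _ (by simp)
  have step : ∀ k, target r c ∉ (graphAfter c k).support →
      target r c ∉ (graphAfter c (k + 1)).support ∧ (newThreats G r c k).encard ≤ 2 := by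
    intro k hk
    obtain hS | hS := (graphAfter c k).support.eq_empty_or_nonempty
    · -- Nothing has been claimed so far: the `k`-th move of Connector is empty or her first.
      have hck : ∀ j < k, c j = ∅ := by
        intro j hj
        by_contra hne
        obtain ⟨e, he⟩ := Set.nonempty_iff_ne_empty.2 hne
        induction e with | _ u v
        have : u ∈ (graphAfter c k).support := by
          refine SimpleGraph.mem_support _ |>.2 ⟨v, ?_⟩
          rw [graphAfter, SimpleGraph.fromEdgeSet_adj]
          exact ⟨⟨j, hj, he⟩, fun h => hdiag j _ he (by simp [h])⟩
        simp [hS] at this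
      suffices h : target r c ∉ (graphAfter c (k + 1)).support ∧ threats G r c k = ∅ by
        refine ⟨h.1, ?_⟩
        simp [newThreats, h.2]
      obtain hck0 | hck0 := (c k).eq_empty_or_nonempty
      · have he : (graphAfter c (k + 1)).support = ∅ := by
          refine support_graphAfter_of_empty fun i hi => ?_
          obtain hi | rfl := Nat.lt_succ_iff_lt_or_eq.1 hi
          · exact hck i hi
          · exact hck0
        simp [threats, he, hotCut_empty]
      · have hex : ∃ j, (c j).Nonempty := ⟨k, hck0⟩
        have hfind : Nat.find hex = k :=
          (Nat.find_eq_iff hex).2 ⟨hck0, fun n hn => by simp [hck n hn]⟩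
        have htarget : target r c = r (c k) := by
          simp only [target, dif_pos hex]
          convert congrArg (fun n => r (c n)) hfind
        have hgraph : graphAfter c (k + 1) = SimpleGraph.fromEdgeSet (c k) := by
          have : claimed c (k + 1) = c k := by
            ext e
            rw [mem_claimed_succ, or_iff_right_iff_imp]
            rintro ⟨j, hj, he⟩
            simp [hck j hj] at he
          rw [graphAfter, this]
        rw [threats, htarget, hgraph]
        exact hr _ (hc k).2.1
    · have hF : hotCut G (target r c) (graphAfter c k).support ⊆
          claimed (newThreats G r c) k := by
        rw [claimed_newThreats]
        cases k with
        | zero =>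
          rw [support_graphAfter_of_empty (by simp)] at hS
          simp at hS
        | succ k => exact Set.subset_biUnion_of_mem (u := threats G r c) (Nat.lt_succ_self k)
      have hnew : newThreats G r c k =
          hotCut G (target r c) (graphAfter c (k + 1)).support \
            claimed (newThreats G r c) k := by
        rw [claimed_newThreats]
        rfl
      rw [hnew]
      obtain heq | ⟨u₁, v₁, u₂, v₂, hu₁, he₁, hu₂, he₂, heq⟩ :=
        support_graphAfter_succ (hdiag k) (hc k).2.1 (hc k).2.2 hS
      · rw [heq, Set.sdiff_eq_empty.2 hF]
        simpa using hk
      · rw [heq]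
        exact encard_hotCut_sdiff_le hst hN hK hk hF hu₁ ((hc k).1 he₁).1
          (fun h => ((hc k).1 he₁).2 (Or.inr h)) hu₂ ((hc k).1 he₂).1
          (fun h => ((hc k).1 he₂).2 (Or.inr h))
  have hnot : ∀ k, target r c ∉ (graphAfter c k).support := by
    intro k
    induction k with
    | zero => simp [support_graphAfter_of_empty (c := c) (k := 0) (by simp)]
    | succ k ih => exact (step k ih).1
  exact ⟨hnot k, (step k (hnot k)).2⟩

/-- Breaker wins on every graph that is sparse over some set of `17` roots: whatever Connector's
first nonempty move is, one of the roots can serve as his target. -/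
theorem breakerCanIsolate_of_sparse [DecidableEq V] {R : Finset V} {N K : ℕ}
    (hs : Sparse G R N K) (hN : 1 ≤ N) (hR : 17 ≤ R.card) (hK : 4 + 13 * (N + 1) ≤ K) :
    BreakerCanIsolate G 2 2 := by
  have hroot : ∀ M : Set (Sym2 V), ∃ x, M.encard ≤ 2 → x ∈ R ∧
      x ∉ (SimpleGraph.fromEdgeSet M).support ∧
      hotCut G x (SimpleGraph.fromEdgeSet M).support = ∅ := by
    intro M
    by_cases hM : M.encard ≤ 2
    · obtain ⟨C, hC, hMC⟩ := exists_finset_support_fromEdgeSet hM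
      obtain ⟨x, hxR, hxC, hx⟩ := exists_root_hotCut_eq_empty hs hN hR hK hC
      exact ⟨x, fun _ => ⟨hxR, by simpa [hMC] using hxC, by rw [hMC, hx]⟩⟩
    · obtain ⟨x, -⟩ := Finset.card_pos.1 (show 0 < R.card by omega)
      exact ⟨x, fun h => absurd h hM⟩
  choose r hr using hroot
  obtain ⟨σ, hσ⟩ := exists_strategy (newThreats G r) fun c c' k => newThreats_congr
  refine ⟨σ, fun c hc => ?_⟩
  rw [hσ] at hc ⊢
  have hcor := newThreats_correct (K := K) hN (by omega)
    (fun M hM => hs.mono_roots (Finset.singleton_subset_iff.2 (hr M hM).1))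
    (fun M hM => (hr M hM).2) hc
  refine ⟨fun k => ⟨fun e he => ⟨hotCut_subset_edgeSet he.1, ?_⟩, (hcor k).2⟩,
    target r c, fun k => ?_⟩
  · rintro (h | h)
    · exact notMem_claimed_of_mem_threats he.1 h
    · rw [claimed_newThreats] at h
      exact he.2 h
  · exact (SimpleGraph.notMem_support_iff_isIsolated _).1 (hcor k).1

end Strategy

/-! ### Sparsity of the random graph -/

section Random

open MeasureTheory ProbabilityTheory unitInterval

/-- Given edges are all present in the binomial random graph with probability at most the
corresponding power of `p`; it is `0` if one of them is a loop. -/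
lemma binomialRandom_subset_edgeSet_le {V : Type*} [Countable V] (p : I) (T : Finset (Sym2 V)) :
    SimpleGraph.binomialRandom V p {G | (T : Set (Sym2 V)) ⊆ G.edgeSet} ≤
      ENNReal.ofReal ((p : ℝ) ^ T.card) := by
  rw [SimpleGraph.binomialRandom_apply']
  calc _ ≤ setBernoulli Sym2.diagSetᶜ p {s | (T : Set (Sym2 V)) ⊆ s} := by
        apply measure_mono
        rintro _ ⟨G, hG, rfl⟩
        exact hG
    _ = Measure.infinitePi (fun e : Sym2 V => toNNReal p • Measure.dirac (e ∈ Sym2.diagSetᶜ) +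
          toNNReal (σ p) • Measure.dirac False) (Set.pi T fun _ => {True}) := by
        rw [setBernoulli_apply']
        congr 1
        ext f
        simp [Set.subset_def, Set.mem_pi]
    _ = ∏ e ∈ T, (toNNReal p • Measure.dirac (e ∈ Sym2.diagSetᶜ) +
          toNNReal (σ p) • Measure.dirac False : Measure Prop) {True} := by
        rw [Measure.infinitePi_pi]
        intros
        exact .of_discrete
    _ ≤ ∏ e ∈ T, (ENNReal.ofReal (p : ℝ)) := by
        apply Finset.prod_le_prod'
        intro e _
        simp only [Measure.add_apply, Measure.smul_apply, Measure.dirac_apply]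
        have hp : (toNNReal p : ENNReal) ≤ ENNReal.ofReal (p : ℝ) :=
          (ENNReal.ofReal_eq_coe_nnreal p.2.1).ge
        by_cases h : e ∈ Sym2.diagSetᶜ <;> simp [h, hp]
    _ = ENNReal.ofReal ((p : ℝ) ^ T.card) := by
        rw [Finset.prod_const, ENNReal.ofReal_pow p.2.1]

/-- The vertex sets `Y`, weighted by `1 / n` for every vertex outside `R`, have bounded total
weight. -/
lemma sum_rpow_neg_card_sdiff_le {n : ℕ} (hn : 0 < n) (R : Finset (Fin n)) :
    ∑ Y : Finset (Fin n), (n : ℝ)⁻¹ ^ (Y \ R).card ≤ 2 ^ R.card * Real.exp 1 := by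
  have hw : ∀ Y : Finset (Fin n), (n : ℝ)⁻¹ ^ (Y \ R).card =
      ∏ v ∈ Y, (if v ∈ R then 1 else (n : ℝ)⁻¹) := by
    intro Y
    rw [Finset.prod_ite, Finset.prod_const_one, one_mul, Finset.prod_const,
      Finset.sdiff_eq_filter]
  simp_rw [hw]
  rw [← Finset.powerset_univ, ← Finset.prod_one_add]
  have h1 : ∀ v : Fin n, 1 + (if v ∈ R then 1 else (n : ℝ)⁻¹) ≤
      (if v ∈ R then 2 else 1) * (1 + (n : ℝ)⁻¹) := by
    intro v
    have : (0 : ℝ) ≤ (n : ℝ)⁻¹ := by positivity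
    split_ifs <;> linarith
  calc _ ≤ ∏ v : Fin n, ((if v ∈ R then 2 else 1) * (1 + (n : ℝ)⁻¹)) := by
        apply Finset.prod_le_prod
        · intro v _
          split_ifs <;> positivity
        · intro v _
          exact h1 v
    _ = 2 ^ R.card * (1 + (n : ℝ)⁻¹) ^ n := by
        rw [Finset.prod_mul_distrib, Finset.prod_ite_mem, Finset.univ_inter, Finset.prod_const,
          Finset.prod_const, Finset.card_univ, Fintype.card_fin]
    _ ≤ 2 ^ R.card * Real.exp 1 := by
        gcongr
        calc (1 + (n : ℝ)⁻¹) ^ n ≤ Real.exp ((n : ℝ)⁻¹) ^ n := by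
              gcongr
              linarith [Real.add_one_le_exp ((n : ℝ)⁻¹)]
          _ = Real.exp 1 := by
              rw [← Real.exp_nat_mul, mul_inv_cancel₀ (by positivity)]

/-- A set of `t` edges on `a` vertices outside the roots that violates sparsity,
`3 N a < (2 N + 1) t`, is too dense for the random graph: `n ^ a p ^ t` is at most
`n ^ (-1 / (3 N))`. -/
lemma pow_le_of_dense {ε q : ℝ} {n N a t : ℕ} (hn : 1 ≤ n) (hN : 1 ≤ N)
    (hε : 1 / (3 * N : ℝ) ≤ ε) (hq0 : 0 ≤ q) (hq : q ≤ (n : ℝ) ^ (-(2 / 3 : ℝ) - ε))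
    (hd : 3 * N * a < (2 * N + 1) * t) :
    q ^ t ≤ (n : ℝ) ^ (-(1 / (3 * N : ℝ))) * (n : ℝ)⁻¹ ^ a := by
  have hn0 : (0 : ℝ) < n := by positivity
  have hn1 : (1 : ℝ) ≤ n := by exact_mod_cast hn
  have hN0 : (0 : ℝ) < N := by positivity
  calc q ^ t ≤ ((n : ℝ) ^ (-(2 / 3 : ℝ) - ε)) ^ t := by gcongr
    _ = (n : ℝ) ^ ((-(2 / 3 : ℝ) - ε) * t) := by rw [Real.rpow_mul_natCast hn0.le]
    _ ≤ (n : ℝ) ^ (-(1 / (3 * N : ℝ)) + -(a : ℝ)) := by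
        apply Real.rpow_le_rpow_of_exponent_le hn1
        have hd' : (3 * N * a + 1 : ℝ) ≤ (2 * N + 1) * t := by exact_mod_cast hd
        have h1 : (a : ℝ) + 1 / (3 * N) ≤ (2 / 3 + 1 / (3 * N)) * t := by
          have e1 : (a : ℝ) + 1 / (3 * N) = (3 * N * a + 1) / (3 * N) := by field_simp
          have e2 : (2 / 3 + 1 / (3 * N)) * (t : ℝ) = ((2 * N + 1) * t) / (3 * N) := by field_simp
          rw [e1, e2]
          gcongr
        have h2 : (1 / (3 * N : ℝ)) * t ≤ ε * t := by gcongr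
        linarith
    _ = (n : ℝ) ^ (-(1 / (3 * N : ℝ))) * (n : ℝ)⁻¹ ^ a := by
        rw [Real.rpow_add hn0, Real.rpow_neg hn0.le (a : ℝ), Real.rpow_natCast, inv_pow]

/-- First moment bound: the probability that the random graph is not sparse over a given set of
roots is at most a constant times `n ^ (-1 / (3 N))`. -/
lemma binomialRandom_not_sparse_le {ε : ℝ} {n N : ℕ} (K : ℕ) (hn : 1 ≤ n) (hN : 1 ≤ N)
    (hε : 1 / (3 * N : ℝ) ≤ ε) (p : I) (hp : (p : ℝ) ≤ (n : ℝ) ^ (-(2 / 3 : ℝ) - ε))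
    (R : Finset (Fin n)) :
    SimpleGraph.binomialRandom (Fin n) p {G | ¬ Sparse G R N K} ≤
      ENNReal.ofReal
        (2 ^ (K + 1).choose 2 * (2 ^ R.card * Real.exp 1) * (n : ℝ) ^ (-(1 / (3 * N : ℝ)))) := by
  set D : Finset (Fin n) → Finset (Finset (Sym2 (Fin n))) := fun Y =>
    Y.sym2.powerset.filter fun T => 3 * N * (Y \ R).card < (2 * N + 1) * T.card with hD
  set 𝒴 : Finset (Finset (Fin n)) := Finset.univ.filter fun Y => Y.card ≤ K with h𝒴
  have hsub : {G : SimpleGraph (Fin n) | ¬ Sparse G R N K} ⊆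
      ⋃ Y ∈ 𝒴, ⋃ T ∈ D Y, {G | (T : Set (Sym2 (Fin n))) ⊆ G.edgeSet} := by
    classical
    intro G hG
    simp only [Sparse, Set.mem_ofPred_eq, not_forall, not_le] at hG
    obtain ⟨Y, hY, hlt⟩ := hG
    simp only [Set.mem_iUnion]
    refine ⟨Y, by simp [h𝒴, hY], edgesIn G Y, ?_, ?_⟩
    · simp only [hD, Finset.mem_filter, Finset.mem_powerset]
      refine ⟨Finset.filter_subset _ _, ?_⟩
      unfold predim at hlt
      zify
      linarith
    · intro e he
      exact (Finset.mem_filter.1 he).2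
  refine (measure_mono hsub).trans ?_
  have hterm : ∀ Y ∈ 𝒴, SimpleGraph.binomialRandom (Fin n) p
      (⋃ T ∈ D Y, {G | (T : Set (Sym2 (Fin n))) ⊆ G.edgeSet}) ≤
      ENNReal.ofReal (2 ^ (K + 1).choose 2 *
        ((n : ℝ) ^ (-(1 / (3 * N : ℝ))) * (n : ℝ)⁻¹ ^ (Y \ R).card)) := by
    intro Y hY
    refine (measure_biUnion_finset_le _ _).trans ?_
    calc _ ≤ ∑ T ∈ D Y, ENNReal.ofReal
          ((n : ℝ) ^ (-(1 / (3 * N : ℝ))) * (n : ℝ)⁻¹ ^ (Y \ R).card) := by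
          refine Finset.sum_le_sum fun T hT => ?_
          refine (binomialRandom_subset_edgeSet_le p T).trans (ENNReal.ofReal_le_ofReal ?_)
          exact pow_le_of_dense hn hN hε p.2.1 hp (Finset.mem_filter.1 hT).2
      _ = ENNReal.ofReal ((D Y).card *
          ((n : ℝ) ^ (-(1 / (3 * N : ℝ))) * (n : ℝ)⁻¹ ^ (Y \ R).card)) := by
          rw [Finset.sum_const, nsmul_eq_mul,
            ENNReal.ofReal_mul (p := ((D Y).card : ℝ)) (by positivity),
            ENNReal.ofReal_natCast]
      _ ≤ _ := by
          apply ENNReal.ofReal_le_ofReal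
          gcongr
          have h1 : (D Y).card ≤ 2 ^ (K + 1).choose 2 := by
            refine (Finset.card_filter_le _ _).trans ?_
            rw [Finset.card_powerset, Finset.card_sym2]
            have hYK : Y.card ≤ K := (Finset.mem_filter.1 hY).2
            exact Nat.pow_le_pow_right (by norm_num) (Nat.choose_le_choose 2 (by omega))
          exact_mod_cast h1
  calc _ ≤ ∑ Y ∈ 𝒴, ENNReal.ofReal (2 ^ (K + 1).choose 2 *
        ((n : ℝ) ^ (-(1 / (3 * N : ℝ))) * (n : ℝ)⁻¹ ^ (Y \ R).card)) :=
        (measure_biUnion_finset_le _ _).trans (Finset.sum_le_sum hterm)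
    _ = ENNReal.ofReal (∑ Y ∈ 𝒴, 2 ^ (K + 1).choose 2 *
        ((n : ℝ) ^ (-(1 / (3 * N : ℝ))) * (n : ℝ)⁻¹ ^ (Y \ R).card)) :=
        (ENNReal.ofReal_sum_of_nonneg fun _ _ => by positivity).symm
    _ ≤ _ := by
        apply ENNReal.ofReal_le_ofReal
        have h1 : ∑ Y ∈ 𝒴, (n : ℝ)⁻¹ ^ (Y \ R).card ≤ 2 ^ R.card * Real.exp 1 :=
          (Finset.sum_le_sum_of_subset_of_nonneg (Finset.subset_univ _)
            fun _ _ _ => by positivity).trans (sum_rpow_neg_card_sdiff_le hn R)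
        rw [← Finset.mul_sum, ← Finset.mul_sum, mul_assoc, mul_comm (2 ^ R.card * Real.exp 1)]
        gcongr

end Random

end ConnectorBreaker

/-! ### The game on the random graph -/

theorem theorem1p4 (ε : ℝ) (hε : 0 < ε) (p : ℕ → unitInterval)
    (hp : ∀ᶠ n : ℕ in atTop, (p n : ℝ) ≤ (n : ℝ) ^ (-(2 / 3 : ℝ) - ε)) :
    Tendsto
      (fun n : ℕ => SimpleGraph.binomialRandom (Fin n) (p n)
        {G : SimpleGraph (Fin n) | ConnectorBreaker.BreakerCanIsolate G 2 2})
      atTop (𝓝 1) := by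
  obtain ⟨N, hN⟩ := exists_nat_gt (1 / (3 * ε))
  have hN0 : (0 : ℝ) < N := lt_trans (by positivity) hN
  have hN1 : 1 ≤ N := by exact_mod_cast hN0
  have hNε : 1 / (3 * N : ℝ) ≤ ε := by
    rw [div_lt_iff₀ (by positivity)] at hN
    rw [div_le_iff₀ (by positivity)]
    linarith
  set K := 4 + 13 * (N + 1) with hK
  set B : ℝ := 2 ^ (K + 1).choose 2 * (2 ^ 17 * Real.exp 1) with hB
  have hlim : Tendsto
      (fun n : ℕ => 1 - ENNReal.ofReal (B * (n : ℝ) ^ (-(1 / (3 * N : ℝ))))) atTop (𝓝 1) := by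
    have h1 : Tendsto (fun n : ℕ => (n : ℝ) ^ (-(1 / (3 * N : ℝ)))) atTop (𝓝 0) :=
      (tendsto_rpow_neg_atTop (by positivity)).comp tendsto_natCast_atTop_atTop
    have h2 := ENNReal.tendsto_ofReal (h1.const_mul B)
    rw [mul_zero, ENNReal.ofReal_zero] at h2
    simpa using ENNReal.Tendsto.sub tendsto_const_nhds h2 (Or.inl ENNReal.one_ne_top)
  refine tendsto_of_tendsto_of_tendsto_of_le_of_le' hlim tendsto_const_nhds ?_
    (Eventually.of_forall fun n => MeasureTheory.prob_le_one)
  filter_upwards [hp, eventually_ge_atTop 17] with n hpn hn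
  obtain ⟨R, -, hR⟩ := Finset.exists_subset_card_eq
    (s := (Finset.univ : Finset (Fin n))) (n := 17) (by simpa using hn)
  have hbad := ConnectorBreaker.binomialRandom_not_sparse_le K (by omega) hN1 hNε (p n) hpn R
  rw [hR, ← hB] at hbad
  rw [tsub_le_iff_right]
  calc (1 : ENNReal) = SimpleGraph.binomialRandom (Fin n) (p n) Set.univ :=
        MeasureTheory.measure_univ.symm
    _ ≤ SimpleGraph.binomialRandom (Fin n) (p n)
        ({G | ConnectorBreaker.BreakerCanIsolate G 2 2} ∪
          {G | ¬ ConnectorBreaker.Sparse G R N K}) := by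
        apply MeasureTheory.measure_mono
        intro G _
        by_cases hG : ConnectorBreaker.Sparse G R N K
        · exact Or.inl (ConnectorBreaker.breakerCanIsolate_of_sparse hG hN1 hR.ge le_rfl)
        · exact Or.inr hG
    _ ≤ _ := (MeasureTheory.measure_union_le _ _).trans (by gcongr)
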